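/- Let $k$ be an algebraically closed field of characteristic $0$, let $W^\vee=\{x\in k^6 : \sum_{i=0}^5 x_i=0\}$, and let $W$ be its dual space. Let $S_3\subset\mathbb{P}(W^\vee)\cong\mathbb{P}^4$ be the Segre cubic, given by $\sum_{i=0}^5 x_i^3=0$. Let $p_1,\dots,p_{10}$ be its nodes, i.e. the points of the orbit of $(1:1:1:-1:-1:-1)$ under the permutations of the six coordinates. Each point $h\in\mathbb{P}(W)$ can be written uniquely as $(a_0:\dots:a_5)$ with $\sum_i a_i=0$, and corresponds to the hyperplane $H=\{x\in\mathbb{P}(W^\vee):\sum_i a_ix_i=0\}$. Let $P_i\subset\mathbb{P}(W)$ be the set of those $h$ whose hyperplane $H$ contains $p_i$, and let $\mathcal{I}_4\subset\mathbb{P}(W)$ be the Castelnuovo–Richmond quartic, given by $\left(\sum_i a_i^2\right)^2-4\sum_i a_i^4=0$. **Lemma.** Let $h\in\mathbb{P}(W)$ and let $H\subset\mathbb{P}(W^\vee)$ be the dual hyperplane. The hyperplane section $H\cap S_3$ is a one-nodal cubic surface (a cubic surface in $H\cong\mathbb{P}^3$ with exactly one singular point, that point being a node, i.e. an ordinary double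 point) if and only if either $$h\in P_i\setminus\Big(\mathcal{I}_4\cup\bigcup_{j\neq i}P_j\Big)\ \text{ for some } i\in\{1,\dots,10\},\qquad\text{or}\qquad h\in\mathcal{I}_4\setminus\bigcup_{i=1}^{10}P_i .$$ -/

import Mathlib

open scoped LinearAlgebra.Projectivization

noncomputable section

namespace ProjHypersurface

variable {k : Type*} [Field k] {n : ℕ}

/-- The first derivative of the polynomial `F` at `x` in the direction `v`. -/
def dirDeriv (F : MvPolynomial (Fin n) k) (x v : Fin n → k) : k :=
  ∑ i, v i * MvPolynomial.eval x (MvPolynomial.pderiv i F)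

/-- The second derivative (Hessian bilinear form) of the polynomial `F` at `x`
in the directions `v` and `w`. -/
def hessian (F : MvPolynomial (Fin n) k) (x v w : Fin n → k) : k :=
  ∑ i, ∑ j, v i * w j * MvPolynomial.eval x (MvPolynomial.pderiv j (MvPolynomial.pderiv i F))

/-- The point `p` of the projective space `ℙ(L)`, where `L` is a linear subspace of `k ^ n`, is a
singular point of the hypersurface (as a scheme) of `ℙ(L)` cut out by the homogeneous
polynomial `F`: both `F|_L` and the differential of `F|_L` vanish at `p`. -/
def IsSingularAt (F : MvPolynomial (Fin n) k) (L : Submodule k (Fin n → k)) (p : ℙ k L) : Prop :=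
  MvPolynomial.eval (p.rep : Fin n → k) F = 0 ∧
    ∀ v ∈ L, dirDeriv F (p.rep : Fin n → k) v = 0

/-- The point `p` of `ℙ(L)` is a node (ordinary double point) of the hypersurface of `ℙ(L)` cut out
by the homogeneous polynomial `F`: it is a singular point, and the Hessian of `F|_L` at `p = [x]`,
which by singularity of `p` (and Euler's relation) descends to the tangent space `L / k x`
of `ℙ(L)` at `p`, is nondegenerate there.
Equivalently, on an affine chart around `p`, given by a complement `M` of the line `k x` in `L`,
the quadratic part of the local equation `m ↦ F (x + m)` is a nondegenerate quadratic form
(in characteristic different from two). -/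
def IsNodeAt (F : MvPolynomial (Fin n) k) (L : Submodule k (Fin n → k)) (p : ℙ k L) : Prop :=
  IsSingularAt F L p ∧
    ∀ v ∈ L, (∀ w ∈ L, hessian F (p.rep : Fin n → k) v w = 0) →
      v ∈ Submodule.span k {(p.rep : Fin n → k)}

/-- The hypersurface of `ℙ(L)` cut out by `F` is a one-nodal cubic surface: `ℙ(L)` is a projective
`3`-space, `F|_L` is a nonzero cubic form, and the surface has exactly one singular point,
which is a node. -/
structure IsOneNodalCubicSurface (F : MvPolynomial (Fin n) k)
    (L : Submodule k (Fin n → k)) : Prop where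
  finrank_eq : Module.finrank k L = 4
  homogeneous : F.IsHomogeneous 3
  not_vanishing : ∃ x ∈ L, MvPolynomial.eval x F ≠ 0
  existsUnique_node : ∃ p : ℙ k L, IsNodeAt F L p ∧ ∀ q : ℙ k L, IsSingularAt F L q → q = p

end ProjHypersurface

namespace SegreCubic

/-- The five-dimensional space `{x ∈ k ^ 6 | ∑ i, x i = 0}`, whose projectivization `ℙ ^ 4`
contains the Segre cubic. It is the space written `W^∨` in the classical setting, so that the
dual projective space `ℙ(W)` of its hyperplanes is `ℙ k (Module.Dual k (Wdual k))`. -/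
def Wdual (k : Type*) [Field k] : Submodule k (Fin 6 → k) where
  carrier := {x | ∑ i, x i = 0}
  add_mem' {x y} hx hy := by
    change ∑ i, x i = 0 at hx
    change ∑ i, y i = 0 at hy
    change ∑ i, (x + y) i = 0
    simp [Finset.sum_add_distrib, hx, hy]
  zero_mem' := by simp
  smul_mem' c x hx := by
    change ∑ i, x i = 0 at hx
    change ∑ i, (c • x) i = 0
    simp [← Finset.mul_sum, hx]

variable {k : Type*} [Field k]

theorem mem_Wdual {x : Fin 6 → k} : x ∈ Wdual k ↔ ∑ i, x i = 0 := Iff.rfl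

/-- The cubic form `∑ i, x i ^ 3`. The Segre cubic is the hypersurface
of `ℙ k (Wdual k)` that it cuts out. -/
def segreForm (k : Type*) [Field k] : MvPolynomial (Fin 6) k :=
  ∑ i, MvPolynomial.X i ^ 3

/-- The linear subspace `L ⊆ Wdual k ⊆ k ^ 6` of codimension one in `Wdual k` for which
`H = ℙ(L)` is the hyperplane of `ℙ k (Wdual k)` dual to the point `h` of the dual projective space:
the kernel of the linear functional `h`.
The hyperplane section of the Segre cubic by `H` is the hypersurface
of `ℙ(L)` cut out by `segreForm k`. -/
def hyperplane (h : ℙ k (Module.Dual k (Wdual k))) : Submodule k (Fin 6 → k) :=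
  (LinearMap.ker h.rep).map (Wdual k).subtype

/-- The vector `(1, 1, 1, -1, -1, -1)` with its coordinates permuted by `σ`. -/
def nodeVector (k : Type*) [Field k] (σ : Equiv.Perm (Fin 6)) : Wdual k :=
  ⟨fun i => (![1, 1, 1, -1, -1, -1] : Fin 6 → k) (σ i), by
    rw [mem_Wdual, Equiv.sum_comp σ (![1, 1, 1, -1, -1, -1] : Fin 6 → k)]
    simp [Fin.sum_univ_six]⟩

theorem nodeVector_ne_zero (σ : Equiv.Perm (Fin 6)) : nodeVector k σ ≠ 0 := by
  intro h
  have h0 := congrFun (congrArg Subtype.val h) (σ.symm 0)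
  simp [nodeVector] at h0

/-- The set of the ten nodes of the Segre cubic: the orbit of the point `(1 : 1 : 1 : -1 : -1 : -1)`
under the permutations of the six coordinates. -/
def nodes (k : Type*) [Field k] : Set (ℙ k (Wdual k)) :=
  Set.range fun σ : Equiv.Perm (Fin 6) =>
    Projectivization.mk k (nodeVector k σ) (nodeVector_ne_zero σ)

/-- The hyperplane of the dual projective space formed by the hyperplanes of `ℙ k (Wdual k)`
which contain the point `p`. For the ten nodes `p` these are the
hyperplanes `P_1, …, P_10`. -/
def dualHyperplane (p : ℙ k (Wdual k)) : Set (ℙ k (Module.Dual k (Wdual k))) :=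
  {h | h.rep p.rep = 0}

variable [CharZero k]

/-- The projection of the `i`-th standard basis vector to `Wdual k`,
along the line spanned by `(1, 1, 1, 1, 1, 1)`. -/
def projBasis (k : Type*) [Field k] [CharZero k] (i : Fin 6) : Wdual k :=
  ⟨fun j => (if j = i then 1 else 0) - 1 / 6, by
    rw [mem_Wdual]
    simp [Finset.sum_sub_distrib]⟩

/-- The six coordinates, with sum zero, of a linear functional on `Wdual k`. -/
def dualCoord (φ : Module.Dual k (Wdual k)) (i : Fin 6) : k := φ (projBasis k i)

/-- The coordinates of a functional have sum zero. -/
theorem sum_dualCoord (φ : Module.Dual k (Wdual k)) : ∑ i, dualCoord φ i = 0 := by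
  have h : ∑ i, projBasis k i = 0 := by
    ext j
    simp [projBasis, Finset.sum_sub_distrib]
  simp only [dualCoord, ← map_sum, h, map_zero]

/-- The functional with coordinates `a` is `x ↦ ∑ i, a i * x i`. -/
theorem apply_eq_sum_dualCoord (φ : Module.Dual k (Wdual k)) (x : Wdual k) :
    φ x = ∑ i, dualCoord φ i * (x : Fin 6 → k) i := by
  have hx : ∑ i, (x : Fin 6 → k) i = 0 := x.2
  have h : x = ∑ i, (x : Fin 6 → k) i • projBasis k i := by
    ext j
    simp [projBasis, mul_sub, Finset.sum_sub_distrib, ← Finset.sum_mul, hx]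
  conv_lhs => rw [h]
  simp [dualCoord, mul_comm]

/-- The Castelnuovo–Richmond quartic in the dual projective space, whose points are described by
six coordinates `a i` with sum zero (the hyperplane `∑ i, a i * x i = 0` of `ℙ k (Wdual k)`):
the locus where `(∑ i, a i ^ 2) ^ 2 - 4 * ∑ i, a i ^ 4 = 0`. -/
def castelnuovoRichmondQuartic (k : Type*) [Field k] [CharZero k] :
    Set (ℙ k (Module.Dual k (Wdual k))) :=
  {h | (∑ i, dualCoord h.rep i ^ 2) ^ 2 - 4 * ∑ i, dualCoord h.rep i ^ 4 = 0}

end SegreCubic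

end

/-! By Lagrange multipliers, `x` in the hyperplane `H` with coordinates `a` is singular on the
section iff `x i ^ 2 = l + m * a i` for some `l`, `m`. Likewise `v` in `H` is in the kernel of the
Hessian at `x` iff `x i * v i` is affine in `a i`.

If `m = 0`, all squares agree and `x` is one of the ten nodes `n` of the cubic, lying on `H`. The
kernel vectors are combinations of `n` and `a * n`, and the latter lies in `H` iff `∑ a i ^ 2 * n i
= 0`. On the hyperplane dual to `n` the quartic is minus the square of this sum
(`quartic_eq_neg_sq`), so `n` is an ordinary double point of the section exactly off the quartic.

If `m ≠ 0`, `H` is tangent at `x`. Evaluating the sextic with roots `x j` at `x i` shows that `x i`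
times the fifth elementary symmetric function of `x` is a fixed cubic in `a i` (`sqrtCubic_of_sq`).
This determines `x` up to scale if these cubic values are not all zero, and it puts `a` on the
quartic. Conversely, on the quartic that cubic is a square root of `∏ (t - a j)` up to a linear
remainder, so its values at the `a i` form a singular vector. They all vanish only if the `a i`
coincide in pairs, which puts a node on `H`. Nondegeneracy there is `eq_zero_of_mul_eq_const`. -/

noncomputable section

/-! ### Symmetric functions of six coordinates with sum zero. -/

namespace SegreCubic

variable {k : Type*} [Field k]

/-- The monic cubic without quadratic term which approximates a square root of
`∏ j, (t - a j)` when `∑ j, a j = 0`. -/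
def sqrtCubic (a : Fin 6 → k) (t : k) : k :=
  t ^ 3 - (∑ i, a i ^ 2) / 4 * t - (∑ i, a i ^ 3) / 6

/-- The elementary symmetric polynomial of degree five in six variables. -/
def esymmFive (x : Fin 6 → k) : k := ∑ i, ∏ j ∈ Finset.univ.erase i, x j

theorem esymmFive_eq (x : Fin 6 → k) :
    esymmFive x = x 1 * x 2 * x 3 * x 4 * x 5 + x 0 * x 2 * x 3 * x 4 * x 5 +
      x 0 * x 1 * x 3 * x 4 * x 5 + x 0 * x 1 * x 2 * x 4 * x 5 +
      x 0 * x 1 * x 2 * x 3 * x 5 + x 0 * x 1 * x 2 * x 3 * x 4 := by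
  have h0 : (Finset.univ.erase 0 : Finset (Fin 6)) = {1, 2, 3, 4, 5} := by decide
  have h1 : (Finset.univ.erase 1 : Finset (Fin 6)) = {0, 2, 3, 4, 5} := by decide
  have h2 : (Finset.univ.erase 2 : Finset (Fin 6)) = {0, 1, 3, 4, 5} := by decide
  have h3 : (Finset.univ.erase 3 : Finset (Fin 6)) = {0, 1, 2, 4, 5} := by decide
  have h4 : (Finset.univ.erase 4 : Finset (Fin 6)) = {0, 1, 2, 3, 5} := by decide
  have h5 : (Finset.univ.erase 5 : Finset (Fin 6)) = {0, 1, 2, 3, 4} := by decide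
  simp [esymmFive, Fin.sum_univ_six, h0, h1, h2, h3, h4, h5, mul_assoc]

/-- Vieta's formulas together with Newton's identities for six elements. -/
theorem exists_vieta_newton (x : Fin 6 → k) (h1 : ∑ i, x i = 0) :
    ∃ e2 e3 e4 e6 : k,
      (∀ t, ∏ j, (t - x j) =
        t ^ 6 + e2 * t ^ 4 - e3 * t ^ 3 + e4 * t ^ 2 - esymmFive x * t + e6) ∧
      ∑ i, x i ^ 2 = -2 * e2 ∧ ∑ i, x i ^ 3 = 3 * e3 ∧ ∑ i, x i ^ 4 = 2 * e2 ^ 2 - 4 * e4 ∧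
      ∑ i, x i ^ 6 = -e2 * ∑ i, x i ^ 4 + e3 * ∑ i, x i ^ 3 - e4 * ∑ i, x i ^ 2 - 6 * e6 := by
  rw [esymmFive_eq]
  simp only [Fin.sum_univ_six, Fin.prod_univ_six] at *
  generalize x 0 = a at *
  generalize x 1 = b at *
  generalize x 2 = c at *
  generalize x 3 = d at *
  generalize x 4 = e at *
  generalize x 5 = f at *
  obtain rfl : f = -(a + b + c + d + e) := by linear_combination h1
  refine ⟨(a * b + a * c + a * d + a * e + b * c + b * d + b * e + c * d + c * e + d * e) -
      (a + b + c + d + e) ^ 2,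
    (a * b * c + a * b * d + a * b * e + a * c * d + a * c * e + a * d * e + b * c * d +
      b * c * e + b * d * e + c * d * e) - (a + b + c + d + e) *
      (a * b + a * c + a * d + a * e + b * c + b * d + b * e + c * d + c * e + d * e),
    (b * c * d * e + a * c * d * e + a * b * d * e + a * b * c * e + a * b * c * d) -
      (a + b + c + d + e) * (a * b * c + a * b * d + a * b * e + a * c * d + a * c * e +
      a * d * e + b * c * d + b * c * e + b * d * e + c * d * e),
    -(a + b + c + d + e) * (a * b * c * d * e), fun t => ?_, ?_, ?_, ?_, ?_⟩ <;> ring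

/-- Two families with the same multiset of values differ by a permutation of the indices. -/
theorem exists_perm_of_map_univ_eq {ι α : Type*} [Fintype ι] {f g : ι → α}
    (h : Multiset.map f Finset.univ.val = Multiset.map g Finset.univ.val) :
    ∃ σ : Equiv.Perm ι, f = g ∘ σ := by
  classical
  have hc : ∀ c, Nonempty ({i // f i = c} ≃ {i // g i = c}) := fun c => by
    have := congrArg (Multiset.count c) h
    simp only [Multiset.count_map] at this
    refine ⟨Fintype.equivOfCardEq ?_⟩
    rw [Fintype.card_subtype, Fintype.card_subtype]
    simpa [Finset.card, Finset.filter_val, eq_comm] using this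
  let e := fun c => (hc c).some
  refine ⟨(Equiv.sigmaFiberEquiv f).symm.trans
    ((Equiv.sigmaCongrRight e).trans (Equiv.sigmaFiberEquiv g)), funext fun i => ?_⟩
  exact ((e (f i)) ⟨i, rfl⟩).2.symm

/-- A vector `v` with `x i * v i` constant and coordinate sum zero vanishes, when the fifth
elementary symmetric polynomial of `x` does not. -/
theorem eq_zero_of_mul_eq_const {x v : Fin 6 → k} {c : k} (h5 : esymmFive x ≠ 0)
    (hv : ∑ i, v i = 0) (h : ∀ i, x i * v i = c) : v = 0 := by
  have hc : c = 0 := by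
    -- Multiplying `x i * v i = c` by the other five coordinates gives `c * ∏ j ≠ i, x j = v i * ∏
    -- j, x j`; sum over `i`.
    have : c * esymmFive x = (∏ i, x i) * ∑ i, v i := by
      rw [esymmFive, Finset.mul_sum, Finset.mul_sum]
      refine Finset.sum_congr rfl fun i _ => ?_
      rw [← Finset.mul_prod_erase _ _ (Finset.mem_univ i), ← h i]
      ring
    rw [hv, mul_zero] at this
    exact (mul_eq_zero.1 this).resolve_right h5
  subst hc
  by_contra hne
  obtain ⟨i, hi⟩ := Function.ne_iff.1 hne
  have hxi : x i = 0 := (mul_eq_zero.1 (h i)).resolve_right hi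
  -- Two zero coordinates would kill every term of `esymmFive x`. So `v` is supported at `i` alone,
  -- and its sum is zero.
  have hrest : ∀ j, j ≠ i → x j ≠ 0 := fun j hj hxj => h5 <| by
    refine Finset.sum_eq_zero fun m _ => ?_
    by_cases hm : m = i
    · exact Finset.prod_eq_zero (Finset.mem_erase.2 ⟨hm ▸ hj, Finset.mem_univ j⟩) hxj
    · exact Finset.prod_eq_zero (Finset.mem_erase.2 ⟨Ne.symm hm, Finset.mem_univ i⟩) hxi
  apply hi
  rw [Pi.zero_apply, ← hv, Finset.sum_eq_single i (fun j _ hj =>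
    (mul_eq_zero.1 (h j)).resolve_left (hrest j hj)) (by simp)]

variable [CharZero k]

/-- If the squares `y i ^ 2` are an affine function of coordinates `b i` with sum zero, then
`y` is proportional to the values of the cubic `sqrtCubic b`, for `y` on the Segre cubic. -/
theorem sqrtCubic_of_sq {y b : Fin 6 → k} {l : k} (h1 : ∑ i, y i = 0) (h3 : ∑ i, y i ^ 3 = 0)
    (hb : ∀ i, y i ^ 2 = l + b i) (hb0 : ∑ i, b i = 0) (i : Fin 6) :
    sqrtCubic b (b i) = esymmFive y * y i := by
  obtain ⟨e2, e3, e4, e6, hp, n2, n3, n4, n6⟩ := exists_vieta_newton y h1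
  -- Once `e3 = 0`, the only odd term of the sextic is the linear one, so its vanishing at `y i`
  -- writes `esymmFive y * y i` as a cubic in `y i ^ 2`. The shift by `l` removes the quadratic
  -- term.
  have hf := hp (y i)
  rw [Finset.prod_eq_zero (Finset.mem_univ i) (sub_self _)] at hf
  have he3 : e3 = 0 := by
    have : (3 : k) * e3 = 0 := by rw [← n3, h3]
    simpa using this
  have hl : 6 * l = -2 * e2 := by
    rw [← n2, Finset.sum_congr rfl fun i _ => hb i, Finset.sum_add_distrib, hb0]; simp
  have hl' : e2 = -3 * l := by linear_combination hl / 2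
  have hbi : ∀ i, b i = y i ^ 2 - l := fun i => by rw [hb i]; ring
  have hs2 : ∑ i, b i ^ 2 = ∑ i, y i ^ 4 - 2 * l * ∑ i, y i ^ 2 + 6 * l ^ 2 := by
    simp only [hbi, Fin.sum_univ_six]; ring
  have hs3 : ∑ i, b i ^ 3 = ∑ i, y i ^ 6 - 3 * l * ∑ i, y i ^ 4 + 3 * l ^ 2 * ∑ i, y i ^ 2
      - 6 * l ^ 3 := by
    simp only [hbi, Fin.sum_univ_six]; ring
  rw [sqrtCubic, hs2, hs3, n6, n4, n2, n3, he3, hbi i, hl']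
  rw [he3, hl'] at hf
  linear_combination -hf

/-- The Castelnuovo–Richmond quartic is the condition for the sextic with roots `a j` to differ
from the square of a cubic by a polynomial of degree one. -/
theorem exists_prod_eq_sqrtCubic_sq {a : Fin 6 → k} (h1 : ∑ i, a i = 0)
    (h4 : (∑ i, a i ^ 2) ^ 2 - 4 * ∑ i, a i ^ 4 = 0) :
    ∃ α β : k, ∀ t, ∏ j, (t - a j) = sqrtCubic a t ^ 2 - (α * t + β) := by
  obtain ⟨e2, e3, e4, e6, hp, n2, n3, n4, -⟩ := exists_vieta_newton a h1
  refine ⟨esymmFive a - e2 * e3 / 2, e3 ^ 2 / 4 - e6, fun t => ?_⟩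
  rw [n2, n4] at h4
  rw [hp, sqrtCubic, n2, n3]
  linear_combination t ^ 2 * h4 / 16

theorem sum_sqrtCubic {a : Fin 6 → k} (h1 : ∑ i, a i = 0) : ∑ i, sqrtCubic a (a i) = 0 := by
  simp only [sqrtCubic, Finset.sum_sub_distrib, ← Finset.mul_sum, h1]
  simp
  ring

/-- The quartic is thus the condition that the vector of cubic values lies on the hyperplane `a`;
both directions of the tangent case use this. -/
theorem sum_mul_sqrtCubic {a : Fin 6 → k} (h1 : ∑ i, a i = 0) :
    4 * ∑ i, a i * sqrtCubic a (a i) = -((∑ i, a i ^ 2) ^ 2 - 4 * ∑ i, a i ^ 4) := by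
  have : ∀ i, a i * sqrtCubic a (a i) =
      a i ^ 4 - (∑ i, a i ^ 2) / 4 * a i ^ 2 - (∑ i, a i ^ 3) / 6 * a i := fun i => by
    rw [sqrtCubic]; ring
  simp only [this, Finset.sum_sub_distrib, ← Finset.mul_sum, h1]
  ring

/-- If the cubic `sqrtCubic a` is an exact square root, the `a i` coincide in pairs. -/
theorem exists_perm_of_prod_eq_sq {a : Fin 6 → k}
    (h : ∀ t, ∏ j, (t - a j) = sqrtCubic a t ^ 2) :
    ∃ (σ : Equiv.Perm (Fin 6)) (r : Fin 3 → k),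
      a = (![r 0, r 1, r 2, r 0, r 1, r 2] : Fin 6 → k) ∘ σ := by
  open Polynomial in
  let q : k[X] := X ^ 3 - C ((∑ i, a i ^ 2) / 4) * X - C ((∑ i, a i ^ 3) / 6)
  have hq : ∏ j, (Polynomial.X - Polynomial.C (a j)) = q ^ 2 := by
    refine Polynomial.funext fun t => ?_
    simpa [Polynomial.eval_prod, q, sqrtCubic] using h t
  have hr : Multiset.map a Finset.univ.val = 2 • q.roots := by
    rw [← Polynomial.roots_pow, ← hq, ← Polynomial.roots_multiset_prod_X_sub_C
      (Multiset.map a Finset.univ.val), Multiset.map_map]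
    rfl
  -- The six `a j` are the roots of `q` taken twice, so `q` has three roots in `k`.
  have hc : q.roots.card = 3 := by
    have := congrArg Multiset.card hr
    simp at this
    omega
  obtain ⟨r0, r1, r2, hr'⟩ := Multiset.card_eq_three.1 hc
  obtain ⟨σ, hσ⟩ := exists_perm_of_map_univ_eq (f := a) (g := ![r0, r1, r2, r0, r1, r2]) (by
    rw [hr, hr', two_nsmul]
    rfl)
  exact ⟨σ, ![r0, r1, r2], hσ⟩

/-- A vector with coordinate sum zero whose coordinates have the same nonzero square is
proportional to a permutation of `(1, 1, 1, -1, -1, -1)`. -/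
theorem exists_nodeVector_of_sq {x : Fin 6 → k} {r : k} (hr : r ≠ 0) (h1 : ∑ i, x i = 0)
    (h : ∀ i, x i ^ 2 = r ^ 2) : ∃ σ, x = r • (nodeVector k σ : Fin 6 → k) := by
  classical
  let b : Fin 6 → Bool := fun i => decide (x i = r)
  have hx : ∀ i, x i = if b i then r else -r := fun i => by
    by_cases hi : x i = r
    · simp [b, hi]
    · simpa [b, hi] using (sq_eq_sq_iff_eq_or_eq_neg.1 (h i)).resolve_left hi
  have hcard : (Finset.univ.filter fun i => b i = true).card = 3 := by
    have hs : ∑ i, x i = r * (2 * (Finset.univ.filter fun i => b i = true).card - 6) := by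
      have hy : ∀ i, x i = 2 * r * (if b i = true then 1 else 0) - r := fun i => by
        rw [hx i]; split_ifs <;> ring
      rw [Finset.sum_congr rfl fun i _ => hy i, Finset.sum_sub_distrib, ← Finset.mul_sum,
        Finset.sum_boole]
      simp
      ring
    rw [h1, eq_comm, mul_eq_zero, or_iff_right hr, sub_eq_zero] at hs
    have : 2 * (Finset.univ.filter fun i => b i = true).card = 6 := by exact_mod_cast hs
    omega
  have hm : ∀ b : Fin 6 → Bool, (Finset.univ.filter fun i => b i = true).card = 3 →
      Multiset.map b Finset.univ.val =
        Multiset.map ![true, true, true, false, false, false] Finset.univ.val := by decide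
  obtain ⟨σ, hσ⟩ := exists_perm_of_map_univ_eq (hm b hcard)
  refine ⟨σ, funext fun i => ?_⟩
  have hj : ∀ j : Fin 6,
      (if (![true, true, true, false, false, false] : Fin 6 → Bool) j = true then r else -r) =
        r * (![1, 1, 1, -1, -1, -1] : Fin 6 → k) j := fun j => by
    fin_cases j <;> simp
  rw [hx i, hσ]
  exact hj (σ i)

/-- On the hyperplane dual to the node `(1, 1, 1, -1, -1, -1)`, the Castelnuovo–Richmond quartic
is the double of the quadric `∑ i, a i ^ 2 * n i = 0`. -/
theorem quartic_eq_neg_sq (σ : Equiv.Perm (Fin 6)) {a : Fin 6 → k} (h1 : ∑ i, a i = 0)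
    (hn : ∑ i, a i * (nodeVector k σ : Fin 6 → k) i = 0) :
    (∑ i, a i ^ 2) ^ 2 - 4 * ∑ i, a i ^ 4 =
      -(∑ i, a i ^ 2 * (nodeVector k σ : Fin 6 → k) i) ^ 2 := by
  have key : ∀ b : Fin 6 → k, ∑ i, b i = 0 →
      ∑ i, b i * (![1, 1, 1, -1, -1, -1] : Fin 6 → k) i = 0 →
      (∑ i, b i ^ 2) ^ 2 - 4 * ∑ i, b i ^ 4 =
        -(∑ i, b i ^ 2 * (![1, 1, 1, -1, -1, -1] : Fin 6 → k) i) ^ 2 := fun b h h' => by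
    simp [Fin.sum_univ_six] at h h' ⊢
    generalize b 0 = x at *
    generalize b 1 = y at *
    generalize b 2 = z at *
    generalize b 3 = u at *
    generalize b 4 = v at *
    generalize b 5 = w at *
    -- Each triple has sum zero, so its fourth power sum is half the square of its second power sum.
    -- With second power sums `A`, `B` the quartic becomes `(A + B) ^ 2 - 2 * A ^ 2 - 2 * B ^ 2 =
    -- -(A - B) ^ 2`.
    obtain rfl : z = -x - y := by linear_combination (h + h') / 2
    obtain rfl : w = -u - v := by linear_combination (h - h') / 2
    ring
  have e : ∀ f : Fin 6 → k → k → k, ∑ i, f i (a i) ((nodeVector k σ : Fin 6 → k) i) =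
      ∑ i, f (σ.symm i) (a (σ.symm i)) ((![1, 1, 1, -1, -1, -1] : Fin 6 → k) i) := fun f => by
    rw [← Equiv.sum_comp σ.symm]
    simp [nodeVector]
  rw [e fun _ s t => s * t] at hn
  rw [e fun _ s _ => s] at h1
  rw [e fun _ s t => s ^ 2 * t, e fun _ s _ => s ^ 2, e fun _ s _ => s ^ 4]
  exact key (a ∘ σ.symm) h1 hn

end SegreCubic

/-! ### Singular points and nodes of hyperplane sections via Lagrange multipliers. -/

namespace SegreCubic

variable {k : Type*} [Field k]

open ProjHypersurface

theorem pderiv_segreForm (i : Fin 6) :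
    MvPolynomial.pderiv i (segreForm k) = 3 * MvPolynomial.X i ^ 2 := by
  simp [segreForm, MvPolynomial.pderiv_X, Pi.single_apply, Derivation.leibniz_pow]

theorem eval_segreForm (x : Fin 6 → k) : MvPolynomial.eval x (segreForm k) = ∑ i, x i ^ 3 := by
  simp [segreForm]

theorem dirDeriv_segreForm (x v : Fin 6 → k) :
    dirDeriv (segreForm k) x v = 3 * ∑ i, x i ^ 2 * v i := by
  rw [dirDeriv, Finset.mul_sum]
  refine Finset.sum_congr rfl fun i _ => ?_
  simp [pderiv_segreForm]
  ring

theorem hessian_segreForm (x v w : Fin 6 → k) :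
    hessian (segreForm k) x v w = 6 * ∑ i, x i * v i * w i := by
  rw [hessian, Finset.mul_sum]
  refine Finset.sum_congr rfl fun i _ => ?_
  have : ∀ j, MvPolynomial.eval x (MvPolynomial.pderiv j (MvPolynomial.pderiv i (segreForm k))) =
      if i = j then 6 * x i else 0 := fun j => by
    have h3 : (3 : MvPolynomial (Fin 6) k) = MvPolynomial.C 3 := (map_ofNat _ 3).symm
    rw [pderiv_segreForm, h3, MvPolynomial.pderiv_C_mul, Derivation.leibniz_pow,
      MvPolynomial.pderiv_X]
    by_cases h : i = j
    · subst h; simp; ring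
    · simp [h]
  simp [this]
  ring

theorem segreForm_isHomogeneous : (segreForm k).IsHomogeneous 3 :=
  MvPolynomial.IsHomogeneous.sum _ _ _ fun i _ => MvPolynomial.isHomogeneous_X_pow i 3

/-- Functionals on `k ^ 6` vanishing on the subspace `∑ i, x i = ∑ i, a i * x i = 0`. -/
theorem exists_eq_add_mul {a w : Fin 6 → k}
    (h : ∀ v : Fin 6 → k, ∑ i, v i = 0 → ∑ i, a i * v i = 0 → ∑ i, w i * v i = 0) :
    ∃ l m : k, ∀ i, w i = l + m * a i := by
  let φ : (Fin 6 → k) → (Fin 6 → k) →ₗ[k] k := fun b => ∑ i, b i • LinearMap.proj i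
  have hφ : ∀ b v, φ b v = ∑ i, b i * v i := fun b v => by simp [φ]
  have hm : φ w ∈ Submodule.span k (Set.range ![φ 1, φ a]) := by
    refine mem_span_of_iInf_ker_le_ker fun v hv => ?_
    simp only [Submodule.mem_iInf, LinearMap.mem_ker, Fin.forall_fin_two] at hv
    rw [LinearMap.mem_ker, hφ]
    exact h v (by simpa [hφ] using hv.1) (by simpa [hφ] using hv.2)
  rw [Matrix.range_cons, Matrix.range_cons, Matrix.range_empty, Set.union_empty,
    Set.singleton_union, Submodule.mem_span_pair] at hm
  obtain ⟨l, m, hlm⟩ := hm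
  refine ⟨l, m, fun i => ?_⟩
  have := congrArg (fun f : (Fin 6 → k) →ₗ[k] k => f (Pi.single i 1)) hlm
  simpa [hφ, Pi.single_apply] using this.symm

/-- `x` represents a singular point of the section of the Segre cubic by the hyperplane
with coordinates `a`. -/
structure IsSingularVector (a x : Fin 6 → k) : Prop where
  sum_eq : ∑ i, x i = 0
  sum_mul_eq : ∑ i, a i * x i = 0
  exists_sq : ∃ l m : k, ∀ i, x i ^ 2 = l + m * a i

/-- Euler's relation: the differential vanishes on the hyperplane, in particular at `x` itself. -/
theorem IsSingularVector.sum_pow_three {a x : Fin 6 → k} (hx : IsSingularVector a x) :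
    ∑ i, x i ^ 3 = 0 := by
  obtain ⟨l, m, h⟩ := hx.exists_sq
  have : ∀ i, x i ^ 3 = l * x i + m * (a i * x i) := fun i => by
    rw [pow_succ, h i]; ring
  simp [this, Finset.sum_add_distrib, ← Finset.mul_sum, hx.sum_eq, hx.sum_mul_eq]

theorem IsSingularVector.smul {a x : Fin 6 → k} (hx : IsSingularVector a x) (c : k) :
    IsSingularVector a (c • x) := by
  obtain ⟨l, m, h⟩ := hx.exists_sq
  refine ⟨by simp [← Finset.mul_sum, hx.sum_eq], ?_, c ^ 2 * l, c ^ 2 * m, fun i => ?_⟩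
  · simp [mul_left_comm _ c, ← Finset.mul_sum, hx.sum_mul_eq]
  · simp [mul_pow, h i]; ring

variable [CharZero k]

theorem mem_hyperplane {h : ℙ k (Module.Dual k (Wdual k))} {x : Fin 6 → k} :
    x ∈ hyperplane h ↔ ∑ i, x i = 0 ∧ ∑ i, dualCoord h.rep i * x i = 0 := by
  simp only [hyperplane, Submodule.mem_map, LinearMap.mem_ker, apply_eq_sum_dualCoord]
  constructor
  · rintro ⟨y, hy, rfl⟩
    exact ⟨y.2, hy⟩
  · rintro ⟨h1, h2⟩
    exact ⟨⟨x, h1⟩, h2, rfl⟩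

theorem dualCoord_rep_ne_zero (h : ℙ k (Module.Dual k (Wdual k))) : dualCoord h.rep ≠ 0 := by
  intro h0
  apply h.rep_nonzero
  ext x
  rw [apply_eq_sum_dualCoord, h0]
  simp

theorem isSingularAt_iff {h : ℙ k (Module.Dual k (Wdual k))} (p : ℙ k (hyperplane h)) :
    IsSingularAt (segreForm k) (hyperplane h) p ↔
      IsSingularVector (dualCoord h.rep) (p.rep : Fin 6 → k) := by
  have hp := mem_hyperplane.1 p.rep.2
  simp only [IsSingularAt, eval_segreForm, dirDeriv_segreForm, mem_hyperplane]
  constructor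
  · rintro ⟨-, hs⟩
    exact ⟨hp.1, hp.2, exists_eq_add_mul fun v h1 h2 => by simpa using hs v ⟨h1, h2⟩⟩
  · intro hs
    refine ⟨hs.sum_pow_three, fun v hv => ?_⟩
    obtain ⟨l, m, hlm⟩ := hs.exists_sq
    simp [hlm, add_mul, Finset.sum_add_distrib, mul_assoc, ← Finset.mul_sum, hv.1, hv.2]

theorem isNodeAt_iff {h : ℙ k (Module.Dual k (Wdual k))} (p : ℙ k (hyperplane h)) :
    IsNodeAt (segreForm k) (hyperplane h) p ↔
      IsSingularVector (dualCoord h.rep) (p.rep : Fin 6 → k) ∧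
        ∀ v ∈ hyperplane h, ∀ l m : k,
          (∀ i, (p.rep : Fin 6 → k) i * v i = l + m * dualCoord h.rep i) →
            v ∈ Submodule.span k {(p.rep : Fin 6 → k)} := by
  rw [IsNodeAt, isSingularAt_iff]
  refine and_congr_right fun _ => forall₂_congr fun v _ => ?_
  simp only [hessian_segreForm, mem_hyperplane]
  constructor
  · refine fun hv l m hlm => hv fun w hw => ?_
    simp [hlm, add_mul, Finset.sum_add_distrib, mul_assoc, ← Finset.mul_sum, hw.1, hw.2]
  · intro hv hw
    obtain ⟨l, m, hlm⟩ := exists_eq_add_mul (a := dualCoord h.rep)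
      (w := fun i => (p.rep : Fin 6 → k) i * v i) fun w h1 h2 => by simpa using hw w ⟨h1, h2⟩
    exact hv l m hlm

theorem finrank_Wdual : Module.finrank k (Wdual k) = 5 := by
  let φ : (Fin 6 → k) →ₗ[k] k := ∑ i, LinearMap.proj i
  have hW : Wdual k = LinearMap.ker φ := by
    ext x
    simp [mem_Wdual, φ]
  have hne : φ ≠ 0 := fun h0 => by
    have := congrArg (fun f : (Fin 6 → k) →ₗ[k] k => f (Pi.single 0 1)) h0
    simp [φ] at this
  have := Module.Dual.finrank_ker_add_one_of_ne_zero (f := φ) hne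
  rw [hW]
  simp at this
  omega

theorem finrank_hyperplane (h : ℙ k (Module.Dual k (Wdual k))) :
    Module.finrank k (hyperplane h) = 4 := by
  have := Module.Dual.finrank_ker_add_one_of_ne_zero h.rep_nonzero
  rw [finrank_Wdual] at this
  rw [hyperplane, ← ((LinearMap.ker h.rep).equivMapOfInjective _
    (Wdual k).injective_subtype).finrank_eq]
  omega

/-- A node forces the cubic form not to vanish identically on the hyperplane. -/
theorem exists_eval_ne_zero {h : ℙ k (Module.Dual k (Wdual k))} {p : ℙ k (hyperplane h)}
    (hp : IsNodeAt (segreForm k) (hyperplane h) p) :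
    ∃ x ∈ hyperplane h, MvPolynomial.eval x (segreForm k) ≠ 0 := by
  by_contra! hz
  simp only [eval_segreForm] at hz
  -- By polarization the Hessian would vanish on the whole hyperplane, so nondegeneracy would
  -- squeeze a space of dimension four into a line.
  have hle : hyperplane h ≤ Submodule.span k {(p.rep : Fin 6 → k)} := fun v hv =>
    hp.2 v hv fun w hw => by
      have hx := p.rep.2
      generalize (p.rep : Fin 6 → k) = x at hx
      have e : 6 * ∑ i, x i * v i * w i = ∑ i, (x + v + w) i ^ 3 - ∑ i, (x + v) i ^ 3 -
          ∑ i, (x + w) i ^ 3 - ∑ i, (v + w) i ^ 3 + ∑ i, x i ^ 3 + ∑ i, v i ^ 3 +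
          ∑ i, w i ^ 3 := by
        simp only [Finset.mul_sum, ← Finset.sum_add_distrib, ← Finset.sum_sub_distrib]
        exact Finset.sum_congr rfl fun i _ => by simp; ring
      rw [hessian_segreForm, e, hz _ (add_mem (add_mem hx hv) hw), hz _ (add_mem hx hv),
        hz _ (add_mem hx hw), hz _ (add_mem hv hw), hz _ hx, hz _ hv, hz _ hw]
      simp
  have := (Submodule.finrank_mono hle).trans (finrank_span_le_card _)
  simp [finrank_hyperplane] at this

theorem mem_dualHyperplane_mk {h : ℙ k (Module.Dual k (Wdual k))} {x : Wdual k} (hx : x ≠ 0) :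
    h ∈ dualHyperplane (Projectivization.mk k x hx) ↔
      ∑ i, dualCoord h.rep i * (x : Fin 6 → k) i = 0 := by
  obtain ⟨c, hc⟩ := Projectivization.exists_smul_eq_mk_rep k x hx
  rw [← apply_eq_sum_dualCoord, dualHyperplane, Set.mem_ofPred_eq, ← hc, Units.smul_def, map_smul,
    smul_eq_mul, mul_eq_zero, or_iff_right c.ne_zero]

end SegreCubic

/-! ### Nodes of the cubic, points of tangency, and the one-nodal condition on vectors. -/

namespace SegreCubic

variable {k : Type*} [Field k]

open ProjHypersurface

theorem nodeVector_sq (σ : Equiv.Perm (Fin 6)) (i : Fin 6) :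
    (nodeVector k σ : Fin 6 → k) i ^ 2 = 1 := by
  have hj : ∀ j, (![1, 1, 1, -1, -1, -1] : Fin 6 → k) j ^ 2 = 1 := fun j => by
    fin_cases j <;> simp
  exact hj (σ i)

theorem isSingularVector_nodeVector {a : Fin 6 → k} {σ : Equiv.Perm (Fin 6)}
    (h : ∑ i, a i * (nodeVector k σ : Fin 6 → k) i = 0) :
    IsSingularVector a (nodeVector k σ : Fin 6 → k) :=
  ⟨(nodeVector k σ).2, h, 1, 0, fun i => by simp [nodeVector_sq]⟩

variable [CharZero k]

/-- A singular vector with constant squares represents a node of the Segre cubic. -/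
theorem IsSingularVector.exists_nodeVector {a x : Fin 6 → k} {l : k} (hx : IsSingularVector a x)
    (hx0 : x ≠ 0) (h : ∀ i, x i ^ 2 = l) :
    ∃ (σ : Equiv.Perm (Fin 6)) (r : k), r ≠ 0 ∧ x = r • (nodeVector k σ : Fin 6 → k) ∧
      ∑ i, a i * (nodeVector k σ : Fin 6 → k) i = 0 := by
  obtain ⟨j, hj⟩ := Function.ne_iff.1 hx0
  obtain ⟨σ, hσ⟩ := exists_nodeVector_of_sq hj hx.sum_eq fun i => by rw [h i, h j]
  refine ⟨σ, x j, hj, hσ, ?_⟩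
  have := hx.sum_mul_eq
  rw [hσ] at this
  simp only [Pi.smul_apply, smul_eq_mul, mul_left_comm (a _), ← Finset.mul_sum] at this
  exact (mul_eq_zero.1 this).resolve_left hj

theorem sqrtCubic_smul (a : Fin 6 → k) (m t : k) :
    sqrtCubic (m • a) (m * t) = m ^ 3 * sqrtCubic a t := by
  simp only [sqrtCubic, Pi.smul_apply, smul_eq_mul, mul_pow, ← Finset.mul_sum]
  ring

theorem IsSingularVector.sqrtCubic_eq {a x : Fin 6 → k} {l m : k} (ha : ∑ i, a i = 0)
    (hx : IsSingularVector a x) (hm : m ≠ 0) (h : ∀ i, x i ^ 2 = l + m * a i) (i : Fin 6) :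
    sqrtCubic a (a i) = esymmFive x / m ^ 3 * x i := by
  have := sqrtCubic_of_sq (b := m • a) hx.sum_eq hx.sum_pow_three h
    (by simp [← Finset.mul_sum, ha]) i
  rw [Pi.smul_apply, smul_eq_mul, sqrtCubic_smul] at this
  field_simp
  linear_combination this

theorem IsSingularVector.quartic_eq_zero {a x : Fin 6 → k} {l m : k} (ha : ∑ i, a i = 0)
    (hx : IsSingularVector a x) (hm : m ≠ 0) (h : ∀ i, x i ^ 2 = l + m * a i) :
    (∑ i, a i ^ 2) ^ 2 - 4 * ∑ i, a i ^ 4 = 0 := by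
  have := sum_mul_sqrtCubic ha
  simp only [hx.sqrtCubic_eq ha hm h, mul_left_comm (a _), ← Finset.mul_sum, hx.sum_mul_eq] at this
  linear_combination this

theorem eq_zero_of_const {a : Fin 6 → k} {c : k} (ha : ∑ i, a i = 0) (h : ∀ i, a i = c) :
    a = 0 := by
  have hc : c = 0 := by simpa [h] using ha
  exact funext fun i => by rw [h i, hc]; rfl

/-- Over a point of the quartic on no node hyperplane, the values of `sqrtCubic` give a singular
vector. -/
theorem isSingularVector_sqrtCubic {a : Fin 6 → k} (ha : ∑ i, a i = 0) (ha0 : a ≠ 0)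
    (h4 : (∑ i, a i ^ 2) ^ 2 - 4 * ∑ i, a i ^ 4 = 0)
    (hP : ∀ σ, ∑ i, a i * (nodeVector k σ : Fin 6 → k) i ≠ 0) :
    IsSingularVector a (fun i => sqrtCubic a (a i)) ∧ (fun i => sqrtCubic a (a i)) ≠ 0 := by
  obtain ⟨α, β, hαβ⟩ := exists_prod_eq_sqrtCubic_sq ha h4
  have hsq : ∀ i, sqrtCubic a (a i) ^ 2 = β + α * a i := fun i => by
    have := hαβ (a i)
    rw [Finset.prod_eq_zero (Finset.mem_univ i) (sub_self _)] at this
    linear_combination -this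
  refine ⟨⟨sum_sqrtCubic ha, ?_, β, α, hsq⟩, fun h0 => ?_⟩
  · have := sum_mul_sqrtCubic ha
    rw [h4, neg_zero] at this
    simpa using this
  have hz : ∀ i, β + α * a i = 0 := fun i => by
    rw [← hsq i, show sqrtCubic a (a i) = 0 from congrFun h0 i]; simp
  have hβ : β = 0 := by
    have : ∑ i, (β + α * a i) = 0 := Finset.sum_eq_zero fun i _ => hz i
    simpa [Finset.sum_add_distrib, ← Finset.mul_sum, ha] using this
  have hα : α = 0 := by
    obtain ⟨i, hi⟩ := Function.ne_iff.1 ha0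
    have := hz i
    rw [hβ, zero_add] at this
    exact (mul_eq_zero.1 this).resolve_right hi
  obtain ⟨σ, r, hr⟩ := exists_perm_of_prod_eq_sq (a := a) fun t => by rw [hαβ, hα, hβ]; ring
  apply hP σ
  have key : ∑ i, (![r 0, r 1, r 2, r 0, r 1, r 2] : Fin 6 → k) i *
      (![1, 1, 1, -1, -1, -1] : Fin 6 → k) i = 0 := by
    simp [Fin.sum_univ_six]; ring
  rw [← key, hr, ← Equiv.sum_comp σ (fun i =>
    (![r 0, r 1, r 2, r 0, r 1, r 2] : Fin 6 → k) i * (![1, 1, 1, -1, -1, -1] : Fin 6 → k) i)]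
  rfl

/-- Every condition is invariant under scaling, so chosen representatives of projective points can
be replaced by arbitrary nonzero vectors. -/
theorem isOneNodalCubicSurface_iff (h : ℙ k (Module.Dual k (Wdual k))) :
    IsOneNodalCubicSurface (segreForm k) (hyperplane h) ↔
      ∃ y : Fin 6 → k, y ≠ 0 ∧ IsSingularVector (dualCoord h.rep) y ∧
        (∀ v : Fin 6 → k, ∑ i, v i = 0 → ∑ i, dualCoord h.rep i * v i = 0 → ∀ l m : k,
          (∀ i, y i * v i = l + m * dualCoord h.rep i) → ∃ c : k, c • y = v) ∧
        ∀ z : Fin 6 → k, IsSingularVector (dualCoord h.rep) z → z ≠ 0 → ∃ c : k, c • y = z := by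
  constructor
  · rintro ⟨-, -, -, p, hp, hu⟩
    rw [isNodeAt_iff] at hp
    refine ⟨p.rep, fun h0 => p.rep_nonzero (Subtype.ext h0), hp.1, fun v h1 h2 l m hlm =>
      Submodule.mem_span_singleton.1 (hp.2 v (mem_hyperplane.2 ⟨h1, h2⟩) l m hlm),
      fun z hz hz0 => ?_⟩
    let z' : hyperplane h := ⟨z, mem_hyperplane.2 ⟨hz.sum_eq, hz.sum_mul_eq⟩⟩
    have hz' : z' ≠ 0 := fun h0 => hz0 (congrArg Subtype.val h0)
    obtain ⟨c, hc⟩ := Projectivization.exists_smul_eq_mk_rep k z' hz'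
    have hq := hu (Projectivization.mk k z' hz') (by
      rw [isSingularAt_iff, ← hc]
      exact hz.smul c)
    rw [← p.mk_rep, Projectivization.mk_eq_mk_iff'] at hq
    obtain ⟨d, hd⟩ := hq
    exact ⟨d, congrArg Subtype.val hd⟩
  · rintro ⟨y, hy0, hy, hn, hu⟩
    let y' : hyperplane h := ⟨y, mem_hyperplane.2 ⟨hy.sum_eq, hy.sum_mul_eq⟩⟩
    have hy' : y' ≠ 0 := fun h0 => hy0 (congrArg Subtype.val h0)
    obtain ⟨c, hc⟩ := Projectivization.exists_smul_eq_mk_rep k y' hy'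
    have hrep : ((Projectivization.mk k y' hy').rep : Fin 6 → k) = (c : k) • y := by
      rw [← hc]; rfl
    have hnode : IsNodeAt (segreForm k) (hyperplane h) (Projectivization.mk k y' hy') := by
      rw [isNodeAt_iff, hrep]
      refine ⟨hy.smul c, fun v hv l m hlm => ?_⟩
      rw [mem_hyperplane] at hv
      obtain ⟨d, hd⟩ := hn v hv.1 hv.2 ((c : k)⁻¹ * l) ((c : k)⁻¹ * m) fun i => by
        have := hlm i
        have hc0 : (c : k) ≠ 0 := c.ne_zero
        simp only [Pi.smul_apply, smul_eq_mul] at this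
        field_simp
        linear_combination this
      refine Submodule.mem_span_singleton.2 ⟨d * (c : k)⁻¹, ?_⟩
      rw [smul_smul, mul_assoc, inv_mul_cancel₀ c.ne_zero, mul_one, hd]
    refine ⟨finrank_hyperplane h, segreForm_isHomogeneous, exists_eval_ne_zero hnode, _, hnode,
      fun q hq => ?_⟩
    rw [isSingularAt_iff] at hq
    obtain ⟨d, hd⟩ := hu _ hq fun h0 => q.rep_nonzero (Subtype.ext h0)
    rw [← q.mk_rep, Projectivization.mk_eq_mk_iff']
    exact ⟨d, Subtype.ext hd⟩

end SegreCubic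
end

/-! ### The classification of one-nodal sections. -/

open SegreCubic ProjHypersurface in
theorem mainTheorem10 {k : Type*} [Field k] [IsAlgClosed k] [CharZero k]
    (h : ℙ k (Module.Dual k (SegreCubic.Wdual k))) :
    ProjHypersurface.IsOneNodalCubicSurface (SegreCubic.segreForm k) (SegreCubic.hyperplane h) ↔
      (∃ p ∈ SegreCubic.nodes k,
        h ∈ SegreCubic.dualHyperplane p \
          (SegreCubic.castelnuovoRichmondQuartic k ∪
            ⋃ q ∈ SegreCubic.nodes k \ {p}, SegreCubic.dualHyperplane q)) ∨
      h ∈ SegreCubic.castelnuovoRichmondQuartic k \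
        ⋃ p ∈ SegreCubic.nodes k, SegreCubic.dualHyperplane p := by
  have ha := sum_dualCoord h.rep
  have ha0 := dualCoord_rep_ne_zero h
  have hquartic : h ∈ castelnuovoRichmondQuartic k ↔
    (∑ i, dualCoord h.rep i ^ 2) ^ 2 - 4 * ∑ i, dualCoord h.rep i ^ 4 = 0 := Iff.rfl
  have hleft : (∃ p ∈ nodes k, h ∈ dualHyperplane p \ (castelnuovoRichmondQuartic k ∪
      ⋃ q ∈ nodes k \ {p}, dualHyperplane q)) ↔
      ∃ σ, ∑ i, dualCoord h.rep i * (nodeVector k σ : Fin 6 → k) i = 0 ∧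
        h ∉ castelnuovoRichmondQuartic k ∧
        ∀ τ, ∑ i, dualCoord h.rep i * (nodeVector k τ : Fin 6 → k) i = 0 →
          ∃ c : k, c • (nodeVector k σ : Fin 6 → k) = nodeVector k τ := by
    simp only [nodes, Set.exists_range_iff, Set.mem_sdiff, Set.mem_union, Set.mem_iUnion,
      mem_dualHyperplane_mk, not_or, not_exists, Set.mem_singleton_iff]
    refine exists_congr fun σ => and_congr_right fun _ => and_congr_right fun _ => ?_
    constructor
    · intro hq τ hτ
      by_contra! hc
      refine hq _ ⟨⟨τ, rfl⟩, fun he => ?_⟩ ((mem_dualHyperplane_mk _).2 hτ)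
      obtain ⟨c, hc'⟩ := (Projectivization.mk_eq_mk_iff' ..).1 he
      exact hc c (congrArg Subtype.val hc')
    · rintro hq _ ⟨⟨τ, rfl⟩, hne⟩ hτ
      obtain ⟨c, hc⟩ := hq τ ((mem_dualHyperplane_mk _).1 hτ)
      exact hne ((Projectivization.mk_eq_mk_iff' ..).2 ⟨c, Subtype.ext hc⟩)
  have hright : h ∉ ⋃ p ∈ nodes k, dualHyperplane p ↔
      ∀ σ, ∑ i, dualCoord h.rep i * (nodeVector k σ : Fin 6 → k) i ≠ 0 := by
    simp [nodes, mem_dualHyperplane_mk]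
  rw [isOneNodalCubicSurface_iff, hleft, Set.mem_sdiff, hright, hquartic]
  generalize dualCoord h.rep = a at *
  have hne : ∀ σ, (nodeVector k σ : Fin 6 → k) ≠ 0 := fun σ h0 =>
    nodeVector_ne_zero σ (Subtype.ext h0)
  constructor
  · rintro ⟨y, hy0, hy, hn, hu⟩
    obtain ⟨l, m, hlm⟩ := hy.exists_sq
    by_cases hm : m = 0
    · obtain ⟨σ, r, hr, hyσ, hσ⟩ := hy.exists_nodeVector (l := l) hy0 fun i => by simp [hlm, hm]
      refine Or.inl ⟨σ, hσ, fun h4 => ?_, fun τ hτ => ?_⟩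
      · rw [quartic_eq_neg_sq σ ha hσ, neg_eq_zero, sq_eq_zero_iff] at h4
        -- On the quartic, `a * y` is a second kernel vector of the Hessian; proportionality to `y`
        -- would make `a` constant, hence zero.
        obtain ⟨c, hc⟩ := hn (fun i => a i * y i) hy.sum_mul_eq (by
          have e : ∀ i, a i * (a i * y i) = r * (a i ^ 2 * (nodeVector k σ : Fin 6 → k) i) :=
            fun i => by rw [hyσ, Pi.smul_apply, smul_eq_mul]; ring
          simp only [e, ← Finset.mul_sum, h4, mul_zero]) 0 l fun i => by
            linear_combination a i * hlm i + a i * a i * hm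
        refine ha0 (eq_zero_of_const (c := c) ha fun i => ?_)
        have hyi : y i ≠ 0 := fun h0 => by
          have := nodeVector_sq (k := k) σ i
          rw [hyσ] at h0
          rw [(mul_eq_zero.1 h0).resolve_left hr] at this
          simp at this
        exact (mul_right_cancel₀ hyi (congrFun hc i)).symm
      · obtain ⟨c, hc⟩ := hu _ (isSingularVector_nodeVector hτ) (hne τ)
        exact ⟨c * r, by rw [mul_smul, ← hyσ, hc]⟩
    · refine Or.inr ⟨hy.quartic_eq_zero ha hm hlm, fun σ hσ => ?_⟩
      obtain ⟨c, hc⟩ := hu _ (isSingularVector_nodeVector hσ) (hne σ)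
      -- A node on `H` would be proportional to `y`, so the squares `y i ^ 2`, and with them the `a
      -- i`, would be constant.
      have hsq : ∀ i, c ^ 2 * (l + m * a i) = 1 := fun i => by
        rw [← hlm, ← mul_pow, ← nodeVector_sq σ i, ← hc]; rfl
      have hc0 : c ≠ 0 := by
        rintro rfl
        simpa using hsq 0
      refine ha0 (eq_zero_of_const (c := ((c ^ 2)⁻¹ - l) / m) ha fun i => ?_)
      have := hsq i
      field_simp
      linear_combination this
  · rintro (⟨σ, hσ, h4, hu⟩ | ⟨h4, hP⟩)
    · refine ⟨nodeVector k σ, hne σ, isSingularVector_nodeVector hσ,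
        fun v h1 h2 l m hlm => ⟨l, ?_⟩, fun z hz hz0 => ?_⟩
      · rw [quartic_eq_neg_sq σ ha hσ, neg_eq_zero, sq_eq_zero_iff] at h4
        have hv : ∀ i, v i = l * (nodeVector k σ : Fin 6 → k) i +
            m * (a i * (nodeVector k σ : Fin 6 → k) i) := fun i => by
          linear_combination (nodeVector k σ : Fin 6 → k) i * hlm i - v i * nodeVector_sq (k := k) σ i
        have hm : m = 0 := by
          have : ∀ i, a i * v i = l * (a i * (nodeVector k σ : Fin 6 → k) i) +
              m * (a i ^ 2 * (nodeVector k σ : Fin 6 → k) i) := fun i => by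
            rw [hv i]; ring
          simp only [this, Finset.sum_add_distrib, ← Finset.mul_sum, hσ, mul_zero, zero_add] at h2
          exact (mul_eq_zero.1 h2).resolve_right h4
        exact funext fun i => by rw [hv i, hm]; simp
      · obtain ⟨l, m, hlm⟩ := hz.exists_sq
        by_cases hm : m = 0
        · obtain ⟨τ, r, -, hzτ, hτ⟩ :=
            hz.exists_nodeVector (l := l) hz0 fun i => by simp [hlm, hm]
          obtain ⟨c, hc⟩ := hu τ hτ
          exact ⟨r * c, by rw [mul_smul, hc, hzτ]⟩
        · exact absurd (hz.quartic_eq_zero ha hm hlm) h4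
    · obtain ⟨hy, hy0⟩ := isSingularVector_sqrtCubic ha ha0 h4 hP
      have hm0 : ∀ {z : Fin 6 → k} {l m : k}, IsSingularVector a z → z ≠ 0 →
          (∀ i, z i ^ 2 = l + m * a i) → m ≠ 0 := fun {z l m} hz hz0 hlm hm => by
        obtain ⟨σ, -, -, -, hσ⟩ := hz.exists_nodeVector (l := l) hz0 fun i => by simp [hlm, hm]
        exact hP σ hσ
      refine ⟨_, hy0, hy, fun v h1 h2 l m hlm => ?_, fun z hz hz0 => ?_⟩
      · obtain ⟨β, α, hsq⟩ := hy.exists_sq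
        have hα := hm0 hy hy0 hsq
        -- The vector of cubic values is itself singular, so `sqrtCubic_eq` expresses it as a
        -- multiple of itself with factor proportional to its `esymmFive`.
        have h5 : esymmFive (fun i => sqrtCubic a (a i)) ≠ 0 := fun h5 => hy0 <| funext fun i => by
          rw [hy.sqrtCubic_eq ha hα hsq i, h5]; simp
        -- Subtracting `m / α` times the singular vector cancels the `a i` term and leaves constant
        -- products.
        refine ⟨m / α, (sub_eq_zero.1 (eq_zero_of_mul_eq_const (c := l - m * β / α) h5 ?_
          fun i => ?_)).symm⟩
        · simp [Finset.sum_sub_distrib, ← Finset.mul_sum, h1, sum_sqrtCubic ha]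
        · have e1 := hsq i
          have e2 := hlm i
          simp only [Pi.sub_apply, Pi.smul_apply, smul_eq_mul] at e1 e2 ⊢
          field_simp
          linear_combination α * e2 - m * e1
      · obtain ⟨l, m, hlm⟩ := hz.exists_sq
        have hQ := hz.sqrtCubic_eq ha (hm0 hz hz0 hlm) hlm
        have hc : esymmFive z / m ^ 3 ≠ 0 := fun hc => hy0 <| funext fun i => by
          rw [hQ i, hc]; simp
        exact ⟨(esymmFive z / m ^ 3)⁻¹, funext fun i => by
          simp only [Pi.smul_apply, smul_eq_mul]
          rw [hQ i, inv_mul_cancel_left₀ hc]⟩
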